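/- Let $(M,h)$ and $(N,g)$ be smooth, connected, complete Riemannian manifolds (finite-dimensional, second countable, without boundary). Let $W(M)$ denote the set of Borel probability measures on $M$ with finite second moment with respect to the Riemannian distance, and likewise $W(N)$. For $\mu\in W(M)$ let $L^2(\mu)=L^2(TM,\mu)$ be the space of measurable vector fields $v$ on $M$ with $\|v\|_{L^2(\mu)}^2=\int_M h(v,v)\,d\mu<\infty$, modulo equality $\mu$-a.e., and let $$T_\mu W(M):=\overline{\{\nabla\varphi \mid \varphi\in C_c^\infty(M)\}}^{L^2(TM,\mu)}.$$ Let $f:M\to N$ be smooth and proper with $\sup_{x\in M}\|df_x\|<\infty$, where $\|df_x\|$ is the operator norm of $df_x:T_xM\to T_{f(x)}N$ with respect to $h$ and $g$, and let $F:W(M)\to W(N)$, $F(\mu)=f_\#\mu$. A disintegration of $\mu$ along $f$ is a family $(\mu^y)_{y\in N}$ of probability measures on $M$, with $y\mapsto\mu^y(A)$ measurable for every Borel set $A\subset M$, such that $\mu^y(M\setminus f^{-1}(y))=0$ for $f_\#\mu$-a.e. $y$ and $$\int_M u\,d\mu=\int_N\int_{f^{-1}(y)}u(x)\,d\mu^y(x)\,df_\#\mu(y)$$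 for every measurable $u:M\to[0,\infty]$. For a vector field $v$ on $M$ put $$dF_\mu(v)_y:=\int_{f^{-1}(y)}df_x(v_x)\,d\mu^y(x)\in T_yN\quad(y\in f(M)),\qquad dF_\mu(v)_y:=0\quad(y\notin f(M)),$$ where the integral is read as $0$ if it does not converge absolutely. Then for every $\mu\in W(M)$ a disintegration of $\mu$ along $f$ exists, and the formula above defines a bounded linear operator $dF_\mu:T_\mu W(M)\to L^2(F(\mu))=L^2(TN,f_\#\mu)$: for every square-integrable measurable field $v$ whose class lies in $T_\mu W(M)$, the integral converges absolutely for $f_\#\mu$-a.e. $y$, the field $dF_\mu(v)$ is measurable and square-integrable with respect to $f_\#\mu$, and its class in $L^2(F(\mu))$ depends neither on the representative $v$ nor on the chosen disintegration and is linear in the class of $v$. Moreover $$\|dF_\mu\|\le \operatorname*{ess\,sup}_{x\in M}{}^{\mu}\,\|df_x\|,$$ where $\|dF_\mu\|$ is the operator norm and the essential supremum is taken with respect to $\mu$. -/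

import Mathlib

open MeasureTheory ProbabilityTheory Set TopologicalSpace Bundle Manifold
open scoped ContDiff ENNReal Topology

noncomputable section

namespace WassersteinGeometry

/-! Throughout, `M` and `N` are manifolds without boundary modelled on the finite-dimensional real
vector spaces `E` and `E'`; the tangent spaces carry the inner products of a Riemannian metric. -/

section MeasurableSections

variable {B : Type*} [TopologicalSpace B] [MeasurableSpace B] (F : Type*) [NormedAddCommGroup F]
  [NormedSpace ℝ F] {V : B → Type*} [TopologicalSpace (TotalSpace F V)]
  [∀ b, TopologicalSpace (V b)] [FiberBundle F V]

/-- A section of a bundle is measurable if it is Borel measurable as a map from the base into the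
total space. -/
def MeasurableSection (v : ∀ b, V b) : Prop :=
  @Measurable B (TotalSpace F V) _ (borel _) (fun b ↦ ⟨b, v b⟩)

/-- Measurability can be checked on the components in local trivializations. -/
lemma measurableSection_iff [SecondCountableTopology B] [BorelSpace B] [FiniteDimensional ℝ F]
    [MeasurableSpace F] [BorelSpace F] {v : ∀ b, V b} :
    MeasurableSection F v ↔ ∀ b₀ : B,
      Measurable (fun b : (trivializationAt F V b₀).baseSet ↦
        (trivializationAt F V b₀ ⟨b, v b⟩).2) := by
  let : MeasurableSpace (TotalSpace F V) := borel _
  have : BorelSpace (TotalSpace F V) := ⟨rfl⟩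
  constructor
  · intro hv b₀
    replace hv : Measurable (fun b ↦ (⟨b, v b⟩ : TotalSpace F V)) := hv
    set e := trivializationAt F V b₀
    have h1 : Measurable (fun p : e.source ↦ (e p).2) :=
      (continuous_snd.comp (continuousOn_iff_continuous_domRestrict.1 e.continuousOn)).measurable
    have h2 : Measurable (fun b : e.baseSet ↦ (⟨⟨b, v b⟩, e.mem_source.2 b.2⟩ : e.source)) :=
      (hv.comp measurable_subtype_coe).subtype_mk
    exact h1.comp h2
  · intro h
    obtain ⟨s, hs, hcov⟩ := countable_cover_nhds
      (f := fun b₀ : B ↦ (trivializationAt F V b₀).baseSet)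
      (fun b₀ ↦ (trivializationAt F V b₀).open_baseSet.mem_nhds
        (FiberBundle.mem_baseSet_trivializationAt' b₀))
    change Measurable (fun b ↦ (⟨b, v b⟩ : TotalSpace F V))
    intro U hU
    have key : ∀ b₀ : B, MeasurableSet ((trivializationAt F V b₀).baseSet ∩
          (fun b ↦ (⟨b, v b⟩ : TotalSpace F V)) ⁻¹' U) := by
      intro b₀
      have hx := h b₀
      set e := trivializationAt F V b₀
      have h1 : Measurable (fun q : e.target ↦ e.toOpenPartialHomeomorph.symm q) :=
        (continuousOn_iff_continuous_domRestrict.1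
          e.toOpenPartialHomeomorph.continuousOn_symm).measurable
      have h2 : Measurable (fun b : e.baseSet ↦
          (⟨((b : B), (e ⟨b, v b⟩).2), e.mem_target.2 b.2⟩ : e.target)) :=
        (measurable_subtype_coe.prodMk hx).subtype_mk
      have h3 : Measurable (fun b : e.baseSet ↦ (⟨b, v b⟩ : TotalSpace F V)) := by
        have hcomp := h1.comp h2
        convert hcomp using 2 with b
        exact (e.symm_apply_mk_proj (e.mem_source.2 b.2)).symm
      rw [← Subtype.image_preimage_coe]
      exact e.open_baseSet.measurableSet.subtype_image (h3 hU)
    have : (fun b ↦ (⟨b, v b⟩ : TotalSpace F V)) ⁻¹' U =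
        ⋃ b₀ ∈ s, ((trivializationAt F V b₀).baseSet ∩
          (fun b ↦ (⟨b, v b⟩ : TotalSpace F V)) ⁻¹' U) := by
      rw [← iUnion₂_inter, hcov, univ_inter]
    rw [this]
    exact MeasurableSet.biUnion hs fun b₀ _ ↦ key b₀

variable {F}
variable [SecondCountableTopology B] [BorelSpace B] [FiniteDimensional ℝ F]
  [∀ b, AddCommGroup (V b)] [∀ b, Module ℝ (V b)] [VectorBundle ℝ F V]

lemma MeasurableSection.zero : MeasurableSection F (0 : ∀ b, V b) := by
  borelize F
  rw [measurableSection_iff]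
  intro b₀
  convert measurable_const (a := (0 : F)) using 2 with b
  exact ((trivializationAt F V b₀).linear ℝ b.2).map_zero

lemma MeasurableSection.add {v w : ∀ b, V b} (hv : MeasurableSection F v)
    (hw : MeasurableSection F w) : MeasurableSection F (v + w) := by
  borelize F
  rw [measurableSection_iff] at *
  intro b₀
  convert (hv b₀).add (hw b₀) using 2 with b
  exact ((trivializationAt F V b₀).linear ℝ b.2).map_add _ _

lemma MeasurableSection.smul {v : ∀ b, V b} (c : ℝ) (hv : MeasurableSection F v) :
    MeasurableSection F (c • v) := by
  borelize F
  rw [measurableSection_iff] at *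
  intro b₀
  convert (hv b₀).const_smul c using 2 with b
  exact ((trivializationAt F V b₀).linear ℝ b.2).map_smul _ _

end MeasurableSections

section NormMeasurable

variable {B : Type*} [TopologicalSpace B] [MeasurableSpace B] {F : Type*} [NormedAddCommGroup F]
  [NormedSpace ℝ F] {V : B → Type*} [TopologicalSpace (TotalSpace F V)]
  [∀ b, NormedAddCommGroup (V b)] [∀ b, InnerProductSpace ℝ (V b)] [FiberBundle F V]
  [VectorBundle ℝ F V] [IsContinuousRiemannianBundle F V]

lemma MeasurableSection.measurable_norm {v : ∀ b, V b} (hv : MeasurableSection F v) :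
    Measurable (fun b ↦ ‖v b‖) := by
  let : MeasurableSpace (TotalSpace F V) := borel _
  have : BorelSpace (TotalSpace F V) := ⟨rfl⟩
  have hc : Continuous (fun p : TotalSpace F V ↦ inner ℝ p.2 p.2) :=
    Continuous.inner_bundle (F := F) (E := V) (b := fun p : TotalSpace F V ↦ p.1)
      (v := fun p ↦ p.2) (w := fun p ↦ p.2) continuous_id continuous_id
  have h := (hc.measurable.comp (show Measurable (fun b ↦ (⟨b, v b⟩ : TotalSpace F V))
    from hv)).sqrt
  simpa [Function.comp_def, ← norm_eq_sqrt_real_inner] using h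

end NormMeasurable

section LTwo

variable {B : Type*} [TopologicalSpace B] [MeasurableSpace B] [SecondCountableTopology B]
  [BorelSpace B] (F : Type*) [NormedAddCommGroup F]
  [NormedSpace ℝ F] [FiniteDimensional ℝ F] (V : B → Type*) [TopologicalSpace (TotalSpace F V)]
  [∀ b, NormedAddCommGroup (V b)] [∀ b, InnerProductSpace ℝ (V b)] [FiberBundle F V]
  [VectorBundle ℝ F V] [IsContinuousRiemannianBundle F V] (μ : Measure B)

/-- The vector space of measurable sections `v` with `∫ ⟨v, v⟩ ∂μ < ∞`. -/
def sqIntegrableSubmodule : Submodule ℝ (∀ b, V b) where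
  carrier := {v | MeasurableSection F v ∧ Integrable (fun b ↦ ‖v b‖ ^ 2) μ}
  zero_mem' := ⟨MeasurableSection.zero, by simp⟩
  add_mem' := by
    rintro v w ⟨hv, hv'⟩ ⟨hw, hw'⟩
    refine ⟨hv.add hw, ((hv'.const_mul 2).add (hw'.const_mul 2)).mono'
      ((hv.add hw).measurable_norm.pow_const 2).aestronglyMeasurable (ae_of_all _ fun b ↦ ?_)⟩
    simp only [Real.norm_eq_abs, abs_pow, abs_norm, Pi.add_apply]
    nlinarith [norm_add_le (v b) (w b), sq_nonneg (‖v b‖ - ‖w b‖), norm_nonneg (v b + w b),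
      norm_nonneg (v b), norm_nonneg (w b)]
  smul_mem' := by
    rintro c v ⟨hv, hv'⟩
    refine ⟨hv.smul c, ?_⟩
    simpa [norm_smul, mul_pow] using hv'.const_mul (c ^ 2)

/-- The type of square-integrable measurable sections. It is kept apart from the submodule of
the product `∀ b, V b`, so that it carries the `L²` topology and not the product topology. -/
def SqIntegrableSection : Type _ := sqIntegrableSubmodule F V μ

instance : AddCommGroup (SqIntegrableSection F V μ) :=
  inferInstanceAs (AddCommGroup (sqIntegrableSubmodule F V μ))

instance : Module ℝ (SqIntegrableSection F V μ) :=
  inferInstanceAs (Module ℝ (sqIntegrableSubmodule F V μ))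

variable {F V μ}

/-- The underlying section. -/
def SqIntegrableSection.field (v : SqIntegrableSection F V μ) (b : B) : V b := v.1 b

/-- A square-integrable measurable section as an element of `SqIntegrableSection`. -/
def SqIntegrableSection.of (v : ∀ b, V b) (hv : MeasurableSection F v)
    (hv' : Integrable (fun b ↦ ‖v b‖ ^ 2) μ) : SqIntegrableSection F V μ := ⟨v, hv, hv'⟩

lemma SqIntegrableSection.integrable_inner (v w : SqIntegrableSection F V μ) :
    Integrable (fun b ↦ inner ℝ (v.field b) (w.field b)) μ := by
  have h := (((v + w).2.2.sub v.2.2).sub w.2.2).div_const 2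
  refine h.congr (ae_of_all _ fun b ↦ ?_)
  change (‖v.field b + w.field b‖ ^ 2 - ‖v.field b‖ ^ 2 - ‖w.field b‖ ^ 2) / 2 = _
  rw [norm_add_sq_real]
  ring

variable (F V μ)

/-- The scalar product `∫ ⟨v, w⟩ ∂μ`. -/
@[reducible] def sqIntegrableCore : PreInnerProductSpace.Core ℝ (SqIntegrableSection F V μ) where
  inner v w := ∫ b, inner ℝ (v.field b) (w.field b) ∂μ
  conj_inner_symm v w := by simp [real_inner_comm]
  re_inner_nonneg v := integral_nonneg fun b ↦ real_inner_self_nonneg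
  add_left u v w := by
    rw [← integral_add (u.integrable_inner w) (v.integrable_inner w)]
    exact integral_congr_ae (ae_of_all _ fun b ↦ inner_add_left (u.field b) (v.field b) (w.field b))
  smul_left v w c := by
    rw [← integral_const_mul]
    exact integral_congr_ae (ae_of_all _ fun b ↦ inner_smul_left (v.field b) (w.field b) c)

instance : SeminormedAddCommGroup (SqIntegrableSection F V μ) :=
  letI := sqIntegrableCore F V μ
  InnerProductSpace.Core.toSeminormedAddCommGroup (𝕜 := ℝ)

instance : InnerProductSpace ℝ (SqIntegrableSection F V μ) :=
  InnerProductSpace.ofCore (sqIntegrableCore F V μ)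

/-- `L²(V, μ)`: square-integrable sections modulo equality `μ`-almost everywhere. The scalar product
is `∫ ⟨v, w⟩ ∂μ`; the separation quotient identifies sections at `L²`-distance `0`, see
`LTwo.mk_eq_mk_iff`. -/
abbrev LTwo : Type _ := SeparationQuotient (SqIntegrableSection F V μ)

variable {F V μ}

lemma SqIntegrableSection.norm_eq (v : SqIntegrableSection F V μ) :
    ‖v‖ = Real.sqrt (∫ b, ‖v.field b‖ ^ 2 ∂μ) := by
  rw [norm_eq_sqrt_real_inner]
  congr 1
  exact integral_congr_ae (ae_of_all _ fun b ↦ real_inner_self_eq_norm_sq _)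

/-- The class of a square-integrable section. -/
def LTwo.mk (v : SqIntegrableSection F V μ) : LTwo F V μ := SeparationQuotient.mk v

lemma LTwo.mk_eq_mk_iff (v w : SqIntegrableSection F V μ) :
    LTwo.mk v = LTwo.mk w ↔ ∀ᵐ b ∂μ, v.field b = w.field b := by
  rw [LTwo.mk, LTwo.mk, SeparationQuotient.mk_eq_mk, Metric.inseparable_iff, dist_eq_norm,
    SqIntegrableSection.norm_eq, Real.sqrt_eq_zero (integral_nonneg fun _ ↦ by positivity),
    show (∫ b, ‖(v - w).field b‖ ^ 2 ∂μ = 0 ↔ _) from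
      integral_eq_zero_iff_of_nonneg (fun _ ↦ by positivity) (v - w).2.2]
  refine ⟨fun h ↦ h.mono fun b hb ↦ ?_, fun h ↦ h.mono fun b hb ↦ ?_⟩
  · have h0 : ‖v.field b - w.field b‖ ^ 2 = 0 := hb
    simpa [sub_eq_zero] using h0
  · change ‖v.field b - w.field b‖ ^ 2 = 0
    simp [hb]

lemma LTwo.norm_mk (v : SqIntegrableSection F V μ) :
    ‖LTwo.mk v‖ = Real.sqrt (∫ b, ‖v.field b‖ ^ 2 ∂μ) := by
  rw [LTwo.mk, SeparationQuotient.norm_mk, SqIntegrableSection.norm_eq]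

end LTwo

section Differential

variable (E : Type*) [NormedAddCommGroup E] [NormedSpace ℝ E]
  {M : Type*} [TopologicalSpace M] [ChartedSpace E M]

/-- The differential of a real function as a linear form on the tangent space. -/
def differential (φ : M → ℝ) (x : M) : TangentSpace 𝓘(ℝ, E) x →L[ℝ] ℝ :=
  mfderiv 𝓘(ℝ, E) 𝓘(ℝ, ℝ) φ x

variable {E}

lemma differential_zero (x : M) : differential E (0 : M → ℝ) x = 0 :=
  mfderiv_const

lemma differential_add {φ ψ : M → ℝ} (hφ : ContMDiff 𝓘(ℝ, E) 𝓘(ℝ, ℝ) ∞ φ)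
    (hψ : ContMDiff 𝓘(ℝ, E) 𝓘(ℝ, ℝ) ∞ ψ) (x : M) :
    differential E (φ + ψ) x = differential E φ x + differential E ψ x :=
  mfderiv_add (hφ.mdifferentiableAt (by simp)) (hψ.mdifferentiableAt (by simp))

lemma differential_smul {φ : M → ℝ} (hφ : ContMDiff 𝓘(ℝ, E) 𝓘(ℝ, ℝ) ∞ φ) (c : ℝ) (x : M) :
    differential E (c • φ) x = c • differential E φ x :=
  const_smul_mfderiv (hφ.mdifferentiableAt (by simp)) c

end Differential

section RiemannianManifolds

variable (E : Type*) [NormedAddCommGroup E] [NormedSpace ℝ E]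
  {M : Type*} [TopologicalSpace M] [ChartedSpace E M] [IsManifold 𝓘(ℝ, E) ∞ M]
  [RiemannianBundle (fun x : M ↦ TangentSpace 𝓘(ℝ, E) x)]

instance [h : IsContMDiffRiemannianBundle 𝓘(ℝ, E) ∞ E (fun x : M ↦ TangentSpace 𝓘(ℝ, E) x)] :
    IsContinuousRiemannianBundle E (fun x : M ↦ TangentSpace 𝓘(ℝ, E) x) := by
  obtain ⟨g, hg, hg'⟩ := h.exists_contMDiff
  exact ⟨g, hg.continuous, hg'⟩

instance [FiniteDimensional ℝ E] (x : M) : FiniteDimensional ℝ (TangentSpace 𝓘(ℝ, E) x) :=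
  inferInstanceAs (FiniteDimensional ℝ E)

instance [FiniteDimensional ℝ E] (x : M) : CompleteSpace (TangentSpace 𝓘(ℝ, E) x) :=
  FiniteDimensional.complete ℝ _

/-- The Riemannian gradient: the vector representing the differential of `φ`. -/
def grad [FiniteDimensional ℝ E] (φ : M → ℝ) (x : M) : TangentSpace 𝓘(ℝ, E) x :=
  (InnerProductSpace.toDual ℝ (TangentSpace 𝓘(ℝ, E) x)).symm (differential E φ x)

end RiemannianManifolds

section Wasserstein

variable (E : Type*) [NormedAddCommGroup E] [NormedSpace ℝ E] [FiniteDimensional ℝ E]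
  {M : Type*} [MetricSpace M] [SecondCountableTopology M] [MeasurableSpace M] [BorelSpace M]
  [ChartedSpace E M] [IsManifold 𝓘(ℝ, E) ∞ M]
  [RiemannianBundle (fun x : M ↦ TangentSpace 𝓘(ℝ, E) x)]
  [IsContMDiffRiemannianBundle 𝓘(ℝ, E) ∞ E (fun x : M ↦ TangentSpace 𝓘(ℝ, E) x)]

/-- The space `Γ²(TM, μ)` of measurable vector fields `v` with `∫ ⟨v, v⟩ ∂μ < ∞`. -/
abbrev SqIntegrableField (μ : Measure M) : Type _ :=
  SqIntegrableSection E (fun x : M ↦ TangentSpace 𝓘(ℝ, E) x) μ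

/-- `L²(TM, μ)`. -/
abbrev LTwoFields (μ : Measure M) : Type _ := LTwo E (fun x : M ↦ TangentSpace 𝓘(ℝ, E) x) μ

/-- The linear subspace `{∇φ ∣ φ ∈ C_c^∞(M)}` of `L²(TM, μ)`. -/
def gradientFields (μ : Measure M) : Submodule ℝ (LTwoFields E μ) where
  carrier := {u | ∃ (φ : M → ℝ) (v : SqIntegrableField E μ), ContMDiff 𝓘(ℝ, E) 𝓘(ℝ, ℝ) ∞ φ ∧
    HasCompactSupport φ ∧ (∀ x, v.field x = grad E φ x) ∧ u = LTwo.mk v}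
  zero_mem' := by
    refine ⟨0, 0, contMDiff_const, HasCompactSupport.zero, fun x ↦ ?_, rfl⟩
    rw [grad, differential_zero, map_zero]
    rfl
  add_mem' := by
    rintro _ _ ⟨φ, v, hφ, hφ', hv, rfl⟩ ⟨ψ, w, hψ, hψ', hw, rfl⟩
    refine ⟨φ + ψ, v + w, hφ.add hψ, hφ'.add hψ', fun x ↦ ?_, rfl⟩
    rw [grad, differential_add hφ hψ, map_add]
    exact congrArg₂ (· + ·) (hv x) (hw x)
  smul_mem' := by
    rintro c _ ⟨φ, v, hφ, hφ', hv, rfl⟩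
    have hc : ContMDiff 𝓘(ℝ, E) 𝓘(ℝ, ℝ) ∞ (c • φ) :=
      (contDiff_const_smul c).comp_contMDiff hφ
    refine ⟨c • φ, c • v, hc, hφ'.smul_left (f := fun _ ↦ c), fun x ↦ ?_, rfl⟩
    rw [grad, differential_smul hφ, map_smulₛₗ]
    exact congrArg (c • ·) (hv x)

/-- The tangent space `T_μ W(M)`: the closure of the gradients in `L²(TM, μ)`. -/
def wassersteinTangent (μ : Measure M) : Submodule ℝ (LTwoFields E μ) :=
  (gradientFields E μ).topologicalClosure

end Wasserstein

section Maps

/-- The Wasserstein space `W(M) = W₂(M)` as a set: Borel probability measures with finite second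
moment. As distances are finite, the choice of the base point `x₀` does not matter. -/
structure WassersteinSpace (M : Type*) [MetricSpace M] [MeasurableSpace M] where
  /-- The underlying measure. -/
  toMeasure : Measure M
  isProbabilityMeasure : IsProbabilityMeasure toMeasure
  finite_moment : ∃ x₀ : M, ∫⁻ x, edist x₀ x ^ 2 ∂toMeasure < ⊤

variable (E : Type*) [NormedAddCommGroup E] [NormedSpace ℝ E]
  (E' : Type*) [NormedAddCommGroup E'] [NormedSpace ℝ E']
  {M : Type*} [MetricSpace M] [ChartedSpace E M]
  [RiemannianBundle (fun x : M ↦ TangentSpace 𝓘(ℝ, E) x)]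
  {N : Type*} [MetricSpace N] [ChartedSpace E' N]
  [RiemannianBundle (fun y : N ↦ TangentSpace 𝓘(ℝ, E') y)]

lemma edist_le_of_mfderiv_le [IsRiemannianManifold 𝓘(ℝ, E) M] [IsRiemannianManifold 𝓘(ℝ, E') N]
    {f : M → N} (hf : ContMDiff 𝓘(ℝ, E) 𝓘(ℝ, E') ∞ f) {C : NNReal}
    (hC : ∀ x, ‖mfderiv 𝓘(ℝ, E) 𝓘(ℝ, E') f x‖ ≤ C) (x x' : M) :
    edist (f x) (f x') ≤ C * edist x x' := by
  have hf1 : ContMDiff 𝓘(ℝ, E) 𝓘(ℝ, E') 1 f := hf.of_le (by simp)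
  rw [IsRiemannianManifold.out (I := 𝓘(ℝ, E)) x x', IsRiemannianManifold.out (I := 𝓘(ℝ, E')) (f x)]
  set d := riemannianEDist 𝓘(ℝ, E) x x' with hd
  have hd_top : d < ⊤ := by
    rw [hd, ← IsRiemannianManifold.out (I := 𝓘(ℝ, E)) x x']
    exact edist_lt_top x x'
  have key : ∀ r, d < r → riemannianEDist 𝓘(ℝ, E') (f x) (f x') ≤ C * r := by
    intro r hr
    obtain ⟨γ, h0, h1, hγ, hlen, -, -⟩ :=
      exists_lt_locally_constant_of_riemannianEDist_lt hr zero_lt_one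
    calc riemannianEDist 𝓘(ℝ, E') (f x) (f x')
        ≤ pathELength 𝓘(ℝ, E') (f ∘ γ) 0 1 :=
          riemannianEDist_le_pathELength (hf1.comp hγ).contMDiffOn (by simp [h0]) (by simp [h1])
            zero_le_one
      _ ≤ C * pathELength 𝓘(ℝ, E) γ 0 1 := by
          rw [pathELength_eq_lintegral_mfderiv_Icc, pathELength_eq_lintegral_mfderiv_Icc,
            ← lintegral_const_mul' _ _ ENNReal.coe_ne_top]
          refine lintegral_mono fun t ↦ ?_
          rw [mfderiv_comp t (hf1.mdifferentiableAt one_ne_zero)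
            (hγ.mdifferentiableAt one_ne_zero)]
          refine ((mfderiv 𝓘(ℝ, E) 𝓘(ℝ, E') f (γ t)).le_opENorm
            (mfderiv 𝓘(ℝ, ℝ) 𝓘(ℝ, E) γ t 1)).trans ?_
          gcongr
          rw [← ofReal_norm, ← ENNReal.ofReal_coe_nnreal]
          exact ENNReal.ofReal_le_ofReal (hC _)
      _ ≤ C * r := by gcongr
  have hlim : Filter.Tendsto (fun r : ℝ≥0∞ ↦ C * r) (𝓝[>] d) (𝓝 (C * d)) :=
    ((ENNReal.continuous_const_mul ENNReal.coe_ne_top).tendsto d).mono_left nhdsWithin_le_nhds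
  have : (𝓝[>] d).NeBot := nhdsGT_neBot_of_exists_gt ⟨⊤, hd_top⟩
  exact ge_of_tendsto hlim (Filter.eventually_of_mem self_mem_nhdsWithin fun r hr ↦ key r hr)

section PushForward

variable [IsRiemannianManifold 𝓘(ℝ, E) M] [IsRiemannianManifold 𝓘(ℝ, E') N]
  [MeasurableSpace M] [BorelSpace M] [MeasurableSpace N] [BorelSpace N]

/-- The map `F = f_# : W(M) → W(N)` induced by a smooth map `f` with bounded differential. -/
def WassersteinSpace.map (f : M → N) (hf : ContMDiff 𝓘(ℝ, E) 𝓘(ℝ, E') ∞ f)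
    (hb : ∃ C : ℝ, ∀ x, ‖mfderiv 𝓘(ℝ, E) 𝓘(ℝ, E') f x‖ ≤ C) (μ : WassersteinSpace M) :
    WassersteinSpace N where
  toMeasure := μ.toMeasure.map f
  isProbabilityMeasure :=
    have := μ.isProbabilityMeasure
    Measure.isProbabilityMeasure_map hf.continuous.measurable.aemeasurable
  finite_moment := by
    obtain ⟨C, hC⟩ := hb
    obtain ⟨x₀, hx₀⟩ := μ.finite_moment
    refine ⟨f x₀, ?_⟩
    have hC' : ∀ x, ‖mfderiv 𝓘(ℝ, E) 𝓘(ℝ, E') f x‖ ≤ C.toNNReal := fun x ↦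
      (hC x).trans (Real.le_coe_toNNReal C)
    have hm : Measurable (fun y : N ↦ edist (f x₀) y ^ 2) :=
      (continuous_const.edist continuous_id).measurable.pow_const 2
    rw [lintegral_map hm hf.continuous.measurable]
    calc ∫⁻ x, edist (f x₀) (f x) ^ 2 ∂μ.toMeasure
        ≤ ∫⁻ x, (C.toNNReal : ℝ≥0∞) ^ 2 * edist x₀ x ^ 2 ∂μ.toMeasure := by
          refine lintegral_mono fun x ↦ ?_
          rw [← mul_pow]
          gcongr
          exact edist_le_of_mfderiv_le E E' hf hC' x₀ x
      _ = (C.toNNReal : ℝ≥0∞) ^ 2 * ∫⁻ x, edist x₀ x ^ 2 ∂μ.toMeasure :=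
          lintegral_const_mul' _ _ (by simp)
      _ < ⊤ := ENNReal.mul_lt_top (by simp) hx₀

end PushForward

/-- For `x` in the fibre `f⁻¹(y)`, the vector `df_x(v_x)` as an element of `T_y N = T_{f(x)} N`;
the value `0` off the fibre is never used. -/
def fibreVector (f : M → N) (v : ∀ x : M, TangentSpace 𝓘(ℝ, E) x) (y : N) (x : M) :
    TangentSpace 𝓘(ℝ, E') y :=
  open Classical in
  if h : f x = y then h ▸ mfderiv 𝓘(ℝ, E) 𝓘(ℝ, E') f x (v x) else 0

variable [MeasurableSpace M] [MeasurableSpace N]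

/-- A disintegration `(μ^y)_{y ∈ N}` of `μ` along `f`: a measurable family of probability measures
on `M` such that `μ^y` is concentrated on `f⁻¹(y)` for `f_# μ`-almost every `y` and
`dμ(x) = dμ^y(x) df_#μ(y)`. -/
structure IsDisintegration (f : M → N) (μ : Measure M) (κ : Kernel N M) : Prop where
  isProbability : ∀ y, IsProbabilityMeasure (κ y)
  concentrated : ∀ᵐ y ∂(μ.map f), κ y (f ⁻¹' {y})ᶜ = 0
  lintegral_eq : ∀ g : M → ℝ≥0∞, Measurable g →
    ∫⁻ x, g x ∂μ = ∫⁻ y, ∫⁻ x in f ⁻¹' {y}, g x ∂(κ y) ∂(μ.map f)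

/-- The vector field `y ↦ ∫_{f⁻¹(y)} df_x(v_x) dμ^y(x)` on `N`. It vanishes for `y ∉ f(M)`, where
the fibre is empty. -/
def fibreAverage (f : M → N) (κ : Kernel N M) (v : ∀ x : M, TangentSpace 𝓘(ℝ, E) x) (y : N) :
    TangentSpace 𝓘(ℝ, E') y :=
  ∫ x in f ⁻¹' {y}, fibreVector E E' f v y x ∂(κ y)

end Maps

end WassersteinGeometry

end

open WassersteinGeometry

/-!
Write `ν = f_# μ`. A disintegration is the same thing as a Markov kernel `κ` whose composition
product with `ν` is the law of `x ↦ (f x, x)` under `μ`. Existence and uniqueness `ν`-a.e. therefore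
follow from the theory of regular conditional distributions, available because `M` is Polish
(`isDisintegration_condDistrib`, `IsDisintegration.ae_eq`).

Fix a disintegration. Along the fibre over `y` the vectors `df_x(v_x)` all lie in `T_y N`, and
Cauchy–Schwarz for the probability measure `κ y` gives
`‖∫ df_x(v_x) dκ^y‖² ≤ ∫ ‖df_x(v_x)‖² dκ^y`. Integrating in `y` yields
`∫ ‖dF(v)‖² dν ≤ ∫ ‖df_x(v_x)‖² dμ ≤ (ess sup ‖df‖)² ∫ ‖v‖² dμ`
(`IsDisintegration.lintegral_enorm_fibreAverage_sq_le`). This is the operator bound; it also gives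
the finiteness of the fibre integrals for almost every `y`, and shows that the class of `dF(v)`
depends only on the class of `v`.

Measurability of `y ↦ dF(v)_y` is checked in local trivializations of `TN`
(`measurableSection_fibreAverage`). There the component of `df_x(v_x)` is a measurable function of
`x` alone, since `v` is measurable and the tangent map of `f` is continuous, and the fibre integral
is the kernel integral of this function restricted to the graph `{(y, x) | f x = y}`.

The estimate holds for every square-integrable field, so the operator is constructed on all of
`L²(TM, μ)` (`IsDisintegration.averageCLM`); `dF_μ` is its restriction to `T_μ W(M)`.
-/

noncomputable section

namespace WassersteinGeometry

/-! ### Disintegrations -/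

section Disintegration

variable {M N : Type*} [MeasurableSpace M] [MeasurableSpace N] {f : M → N} {μ : Measure M}
  {κ : Kernel N M}

/-- A Markov kernel is a disintegration as soon as it disintegrates the law of `(f, id)`: the
fibre condition holds because that law is concentrated on the graph. -/
lemma isDisintegration_of_compProd_eq [MeasurableEq N] [SFinite μ] [IsMarkovKernel κ]
    (hf : Measurable f) (h : μ.map f ⊗ₘ κ = μ.map (fun x ↦ (f x, x))) :
    IsDisintegration f μ κ := by
  have hpair : Measurable (fun x ↦ (f x, x)) := hf.prodMk measurable_id
  have hgraph : MeasurableSet {p : N × M | f p.2 = p.1} :=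
    measurableSet_eq_fun (hf.comp measurable_snd) measurable_fst
  have hconc : ∀ᵐ y ∂(μ.map f), ∀ᵐ x ∂(κ y), f x = y := by
    rw [← Measure.ae_compProd_iff hgraph, h, ae_map_iff hpair.aemeasurable hgraph]
    exact ae_of_all _ fun _ ↦ rfl
  refine ⟨fun y ↦ inferInstance, hconc, fun g hg ↦ ?_⟩
  calc ∫⁻ x, g x ∂μ = ∫⁻ p, g p.2 ∂(μ.map (fun x ↦ (f x, x))) := by
        rw [lintegral_map (f := fun p : N × M ↦ g p.2) (hg.comp measurable_snd) hpair]
    _ = ∫⁻ y, ∫⁻ x, g x ∂(κ y) ∂(μ.map f) := by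
        rw [← h, Measure.lintegral_compProd (f := fun p : N × M ↦ g p.2) (hg.comp measurable_snd)]
    _ = _ := by
        refine lintegral_congr_ae (hconc.mono fun y hy ↦ ?_)
        have : f ⁻¹' {y} =ᵐ[κ y] univ := Filter.eventuallyEq_univ.2 hy
        simp only [setLIntegral_congr this, Measure.restrict_univ]

lemma IsDisintegration.isMarkovKernel (h : IsDisintegration f μ κ) : IsMarkovKernel κ :=
  ⟨h.isProbability⟩

lemma IsDisintegration.ae_restrict_eq (h : IsDisintegration f μ κ) :
    ∀ᵐ y ∂(μ.map f), (κ y).restrict (f ⁻¹' {y}) = κ y :=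
  h.concentrated.mono fun _ hy ↦ Measure.restrict_eq_self_of_ae_mem hy

lemma IsDisintegration.lintegral_eq_lintegral (h : IsDisintegration f μ κ) {g : M → ℝ≥0∞}
    (hg : Measurable g) : ∫⁻ x, g x ∂μ = ∫⁻ y, ∫⁻ x, g x ∂(κ y) ∂(μ.map f) := by
  rw [h.lintegral_eq g hg]
  exact lintegral_congr_ae (h.ae_restrict_eq.mono fun y hy ↦ by simp only [hy])

/-- Conversely, every disintegration disintegrates the law of `(f, id)`; it suffices to compare the
two measures on rectangles. -/
lemma IsDisintegration.compProd_eq [IsFiniteMeasure μ] (h : IsDisintegration f μ κ)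
    (hf : Measurable f) : μ.map f ⊗ₘ κ = μ.map (fun x ↦ (f x, x)) := by
  have := h.isMarkovKernel
  refine Measure.ext_prod fun {s t} hs ht ↦ ?_
  have hpre : (fun x ↦ (f x, x)) ⁻¹' (s ×ˢ t) = f ⁻¹' s ∩ t := rfl
  have hst : MeasurableSet (f ⁻¹' s ∩ t) := (hf hs).inter ht
  rw [Measure.compProd_apply_prod hs ht,
    Measure.map_apply (hf.prodMk measurable_id') (hs.prod ht), hpre, ← lintegral_indicator_one hst,
    h.lintegral_eq_lintegral (measurable_one.indicator hst), ← lintegral_indicator hs]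
  refine lintegral_congr_ae (h.concentrated.mono fun y hy ↦ ?_)
  have hae : ∀ᵐ x ∂(κ y), f x = y := hy
  simp only [lintegral_indicator_one hst]
  by_cases hys : y ∈ s
  · rw [indicator_of_mem hys]
    refine measure_congr (hae.mono fun x hx ↦ ?_)
    refine propext ⟨fun hxt ↦ ⟨?_, hxt⟩, fun hxt ↦ hxt.2⟩
    change f x ∈ s
    rwa [hx]
  · rw [indicator_of_notMem hys, eq_comm]
    refine measure_eq_zero_iff_ae_notMem.2 (hae.mono fun x hx hxs ↦ hys ?_)
    rw [← hx]
    exact hxs.1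

lemma isDisintegration_condDistrib [StandardBorelSpace M] [Nonempty M] [MeasurableEq N]
    [IsFiniteMeasure μ] (hf : Measurable f) : IsDisintegration f μ (condDistrib id f μ) :=
  isDisintegration_of_compProd_eq hf (compProd_map_condDistrib aemeasurable_id)

/-- Disintegrations are unique up to null sets: each is a version of the conditional distribution
of the identity given `f`. -/
lemma IsDisintegration.ae_eq [StandardBorelSpace M] [Nonempty M] [IsFiniteMeasure μ]
    {κ' : Kernel N M} (hf : Measurable f) (h : IsDisintegration f μ κ)
    (h' : IsDisintegration f μ κ') : κ =ᵐ[μ.map f] κ' := by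
  have := h.isMarkovKernel
  have := h'.isMarkovKernel
  exact (condDistrib_ae_eq_of_measure_eq_compProd f aemeasurable_id
    (h.compProd_eq hf).symm).symm.trans (condDistrib_ae_eq_of_measure_eq_compProd f aemeasurable_id
      (h'.compProd_eq hf).symm)

end Disintegration

/-- The Cauchy–Schwarz inequality `‖∫ u‖² ≤ ∫ ‖u‖²` for a measure of total mass at most `1`. -/
lemma enorm_integral_sq_le {X G : Type*} [MeasurableSpace X] [NormedAddCommGroup G]
    [NormedSpace ℝ G] {ρ : Measure X} (hρ : ρ univ ≤ 1) {u : X → G}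
    (hu : AEStronglyMeasurable u ρ) : ‖∫ x, u x ∂ρ‖ₑ ^ 2 ≤ ∫⁻ x, ‖u x‖ₑ ^ 2 ∂ρ := by
  have h1 : ‖∫ x, u x ∂ρ‖ₑ ≤ eLpNorm u 2 ρ := calc
    ‖∫ x, u x ∂ρ‖ₑ ≤ ∫⁻ x, ‖u x‖ₑ ∂ρ := enorm_integral_le_lintegral_enorm _
    _ = eLpNorm u 1 ρ := eLpNorm_one_eq_lintegral_enorm.symm
    _ ≤ eLpNorm u 2 ρ * ρ univ ^ (1 / (1 : ℝ≥0∞).toReal - 1 / (2 : ℝ≥0∞).toReal) :=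
      eLpNorm_le_eLpNorm_mul_rpow_measure_univ one_le_two hu
    _ ≤ eLpNorm u 2 ρ * 1 := by
      gcongr
      exact ENNReal.rpow_le_one hρ (by norm_num)
    _ = eLpNorm u 2 ρ := mul_one _
  calc ‖∫ x, u x ∂ρ‖ₑ ^ 2 ≤ eLpNorm u 2 ρ ^ 2 := by gcongr
    _ = ∫⁻ x, ‖u x‖ₑ ^ 2 ∂ρ := by
      have := eLpNorm_nnreal_pow_eq_lintegral (f := u) (μ := ρ) (p := 2) (by norm_num)
      simpa using this

lemma measurableSet_fiber {M N : Type*} [TopologicalSpace M] [MeasurableSpace M]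
    [OpensMeasurableSpace M] [TopologicalSpace N] [T1Space N] {f : M → N} (hf : Continuous f)
    (y : N) : MeasurableSet (f ⁻¹' {y}) :=
  (isClosed_singleton.preimage hf).measurableSet

/-! ### Fibre averages of vector fields -/

section FibreAverage

variable {E : Type*} [NormedAddCommGroup E] [NormedSpace ℝ E]
  {E' : Type*} [NormedAddCommGroup E'] [NormedSpace ℝ E']
  {M : Type*} [MetricSpace M] [ChartedSpace E M]
  {N : Type*} [MetricSpace N] [ChartedSpace E' N] {f : M → N}
  {v w : ∀ x : M, TangentSpace 𝓘(ℝ, E) x}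

lemma fibreVector_self (x : M) :
    fibreVector E E' f v (f x) x = mfderiv 𝓘(ℝ, E) 𝓘(ℝ, E') f x (v x) := by
  simp [fibreVector]

lemma totalSpace_mk_fibreVector {x : M} {y : N} (h : f x = y) :
    (⟨y, fibreVector E E' f v y x⟩ : TangentBundle 𝓘(ℝ, E') N) =
      tangentMap 𝓘(ℝ, E) 𝓘(ℝ, E') f ⟨x, v x⟩ := by
  subst h
  rw [fibreVector_self]
  rfl

lemma fibreVector_add (y : N) :
    fibreVector E E' f (v + w) y = fibreVector E E' f v y + fibreVector E E' f w y := by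
  ext x
  by_cases h : f x = y
  · subst h
    simp only [Pi.add_apply, fibreVector_self, map_add]
  · simp [fibreVector, h]

lemma fibreVector_smul (c : ℝ) (y : N) :
    fibreVector E E' f (c • v) y = c • fibreVector E E' f v y := by
  ext x
  by_cases h : f x = y
  · subst h
    simp only [Pi.smul_apply, fibreVector_self, map_smul]
  · simp [fibreVector, h]

lemma enorm_fibreVector [RiemannianBundle (fun y : N ↦ TangentSpace 𝓘(ℝ, E') y)]
    {x : M} {y : N} (h : f x = y) :
    ‖fibreVector E E' f v y x‖ₑ = ‖mfderiv 𝓘(ℝ, E) 𝓘(ℝ, E') f x (v x)‖ₑ := by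
  subst h
  rw [fibreVector_self]

variable [IsManifold 𝓘(ℝ, E') ∞ N]

/-- For `x` in the fibre over `y`, the component of `fibreVector` in a trivialization is the value
at `x` of a function on `M` that does not mention `y`. This replaces the integrand, which takes
values in the varying space `T_y N`, by a function into the fixed space `E'`. -/
lemma trivialization_fibreVector {y₀ y : N}
    (hy : y ∈ (trivializationAt E' (TangentSpace 𝓘(ℝ, E') : N → Type _) y₀).baseSet) {x : M}
    (h : f x = y) :
    (trivializationAt E' (TangentSpace 𝓘(ℝ, E')) y₀).continuousLinearEquivAt ℝ y hy
        (fibreVector E E' f v y x) =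
      (trivializationAt E' (TangentSpace 𝓘(ℝ, E') : N → Type _) y₀).source.indicator
        (fun p ↦ (trivializationAt E' (TangentSpace 𝓘(ℝ, E')) y₀ p).2)
        (tangentMap 𝓘(ℝ, E) 𝓘(ℝ, E') f ⟨x, v x⟩) := by
  rw [← totalSpace_mk_fibreVector h, indicator_of_mem]
  · rfl
  · exact (Trivialization.mem_source _).2 hy

/-- The component of a tangent vector in a trivialization, extended by zero outside the domain of
the trivialization, is Borel measurable on the whole tangent bundle. -/
lemma measurable_trivialization_snd [MeasurableSpace E'] [BorelSpace E'] (y₀ : N) :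
    @Measurable (TangentBundle 𝓘(ℝ, E') N) E' (borel _) _
      ((trivializationAt E' (TangentSpace 𝓘(ℝ, E')) y₀).source.indicator
        fun p ↦ (trivializationAt E' (TangentSpace 𝓘(ℝ, E')) y₀ p).2) := by
  let : MeasurableSpace (TangentBundle 𝓘(ℝ, E') N) := borel _
  have : BorelSpace (TangentBundle 𝓘(ℝ, E') N) := ⟨rfl⟩
  set e := trivializationAt E' (TangentSpace 𝓘(ℝ, E') : N → Type _) y₀
  have hc : ContinuousOn (fun p ↦ (e p).2) e.source :=
    continuous_snd.comp_continuousOn e.continuousOn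
  classical
  rw [← piecewise_eq_indicator]
  exact hc.measurable_piecewise continuousOn_const e.open_source.measurableSet

variable [IsManifold 𝓘(ℝ, E) ∞ M]

/-- The tangent map of `f` is continuous, so it carries measurable fields to measurable maps into
the tangent bundle. -/
lemma measurable_tangentMap [MeasurableSpace M] (hf : ContMDiff 𝓘(ℝ, E) 𝓘(ℝ, E') ∞ f)
    (hv : MeasurableSection E v) :
    @Measurable M (TangentBundle 𝓘(ℝ, E') N) _ (borel _)
      (fun x ↦ tangentMap 𝓘(ℝ, E) 𝓘(ℝ, E') f ⟨x, v x⟩) := by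
  have : IsManifold 𝓘(ℝ, E) 1 M := IsManifold.of_le (n := ∞) (by simp)
  have : IsManifold 𝓘(ℝ, E') 1 N := IsManifold.of_le (n := ∞) (by simp)
  have hc := hf.continuous_tangentMap (by simp)
  exact (@Continuous.borel_measurable _ _ _ _ _ hc).comp hv

lemma measurable_enorm_mfderiv_apply [MeasurableSpace M]
    [RiemannianBundle (fun y : N ↦ TangentSpace 𝓘(ℝ, E') y)]
    [IsContMDiffRiemannianBundle 𝓘(ℝ, E') ∞ E' (fun y : N ↦ TangentSpace 𝓘(ℝ, E') y)]
    (hf : ContMDiff 𝓘(ℝ, E) 𝓘(ℝ, E') ∞ f) (hv : MeasurableSection E v) :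
    Measurable (fun x ↦ ‖mfderiv 𝓘(ℝ, E) 𝓘(ℝ, E') f x (v x)‖ₑ) := by
  let : MeasurableSpace (TangentBundle 𝓘(ℝ, E') N) := borel _
  have : BorelSpace (TangentBundle 𝓘(ℝ, E') N) := ⟨rfl⟩
  have hc : Continuous (fun p : TangentBundle 𝓘(ℝ, E') N ↦ inner ℝ p.2 p.2) :=
    Continuous.inner_bundle (F := E') (E := fun y : N ↦ TangentSpace 𝓘(ℝ, E') y)
      (b := fun p : TangentBundle 𝓘(ℝ, E') N ↦ p.1) (v := fun p ↦ p.2) (w := fun p ↦ p.2)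
      continuous_id continuous_id
  have h := (hc.measurable.comp (measurable_tangentMap hf hv)).sqrt.ennreal_ofReal
  convert h using 2 with x
  rw [← ofReal_norm]
  exact congrArg ENNReal.ofReal (norm_eq_sqrt_real_inner _)

variable [FiniteDimensional ℝ E'] [MeasurableSpace M] [BorelSpace M]

lemma aestronglyMeasurable_fibreVector (hf : ContMDiff 𝓘(ℝ, E) 𝓘(ℝ, E') ∞ f)
    (hv : MeasurableSection E v) (y : N) (ρ : Measure M) :
    AEStronglyMeasurable (fibreVector E E' f v y) (ρ.restrict (f ⁻¹' {y})) := by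
  borelize E'
  have hy := FiberBundle.mem_baseSet_trivializationAt' (F := E')
    (E := (TangentSpace 𝓘(ℝ, E') : N → Type _)) y
  set L := (trivializationAt E' (TangentSpace 𝓘(ℝ, E')) y).continuousLinearEquivAt ℝ y hy
  have hm := (measurable_trivialization_snd y).comp (measurable_tangentMap hf hv)
  refine (L.symm.continuous.comp_aestronglyMeasurable hm.aestronglyMeasurable).congr ?_
  filter_upwards [ae_restrict_mem (measurableSet_fiber hf.continuous y)] with x hx
  rw [Function.comp_apply, ← trivialization_fibreVector hy hx]
  exact L.symm_apply_apply _

variable [RiemannianBundle (fun y : N ↦ TangentSpace 𝓘(ℝ, E') y)] [MeasurableSpace N]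
  {μ : Measure M} {κ : Kernel N M}

/-- The square of the fibre average is controlled by the fibre integral of the square. -/
lemma IsDisintegration.enorm_fibreAverage_sq_le (h : IsDisintegration f μ κ)
    (hf : ContMDiff 𝓘(ℝ, E) 𝓘(ℝ, E') ∞ f) {v : ∀ x : M, TangentSpace 𝓘(ℝ, E) x}
    (hv : MeasurableSection E v) (y : N) :
    ‖fibreAverage E E' f κ v y‖ₑ ^ 2 ≤
      ∫⁻ x, ‖mfderiv 𝓘(ℝ, E) 𝓘(ℝ, E') f x (v x)‖ₑ ^ 2 ∂(κ y) := by
  have := h.isProbability y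
  calc ‖fibreAverage E E' f κ v y‖ₑ ^ 2
      ≤ ∫⁻ x in f ⁻¹' {y}, ‖fibreVector E E' f v y x‖ₑ ^ 2 ∂(κ y) :=
        enorm_integral_sq_le (by simpa using prob_le_one)
          (aestronglyMeasurable_fibreVector hf hv y _)
    _ = ∫⁻ x in f ⁻¹' {y}, ‖mfderiv 𝓘(ℝ, E) 𝓘(ℝ, E') f x (v x)‖ₑ ^ 2 ∂(κ y) :=
        setLIntegral_congr_fun (measurableSet_fiber hf.continuous y) fun x hx ↦ by
          simp only [enorm_fibreVector hx]
    _ ≤ _ := setLIntegral_le_lintegral _ _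

variable [BorelSpace N] [SecondCountableTopology N]

/-- In a trivialization the fibre average is the kernel integral of a measurable function on
`N × M`, supported on the graph of `f`. -/
lemma measurableSection_fibreAverage [IsSFiniteKernel κ] (hf : ContMDiff 𝓘(ℝ, E) 𝓘(ℝ, E') ∞ f)
    (hv : MeasurableSection E v) : MeasurableSection E' (fibreAverage E E' f κ v) := by
  borelize E'
  rw [measurableSection_iff]
  intro y₀
  have hm := (measurable_trivialization_snd y₀).comp (measurable_tangentMap hf hv)
  set g : M → E' := _ ∘ fun x ↦ tangentMap 𝓘(ℝ, E) 𝓘(ℝ, E') f ⟨x, v x⟩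
  have hgraph : MeasurableSet {p : N × M | f p.2 = p.1} :=
    measurableSet_eq_fun (hf.continuous.measurable.comp measurable_snd) measurable_fst
  have hint : StronglyMeasurable fun y ↦
      ∫ x, {p : N × M | f p.2 = p.1}.indicator (fun p ↦ g p.2) (y, x) ∂(κ y) :=
    StronglyMeasurable.integral_kernel_prod_right
      ((hm.comp measurable_snd).indicator hgraph).stronglyMeasurable
  convert hint.measurable.comp measurable_subtype_coe using 1
  funext y
  set L := (trivializationAt E' (TangentSpace 𝓘(ℝ, E')) y₀).continuousLinearEquivAt ℝ (y : N) y.2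
  change L (∫ x in f ⁻¹' {(y : N)}, fibreVector E E' f v y x ∂(κ y)) = _
  -- Continuous linear equivalences commute with the integral, convergent or not.
  rw [← L.integral_comp_comm, Function.comp_apply]
  rw [setIntegral_congr_fun (measurableSet_fiber hf.continuous (y : N))
    fun x hx ↦ trivialization_fibreVector y.2 hx,
    ← integral_indicator (measurableSet_fiber hf.continuous _)]
  rfl

end FibreAverage

/-! ### The operator on square-integrable fields -/

section Operator

lemma SqIntegrableSection.enorm_sq {B F : Type*} [TopologicalSpace B] [MeasurableSpace B]
    [SecondCountableTopology B] [BorelSpace B] [NormedAddCommGroup F] [NormedSpace ℝ F]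
    [FiniteDimensional ℝ F] {V : B → Type*} [TopologicalSpace (TotalSpace F V)]
    [∀ b, NormedAddCommGroup (V b)] [∀ b, InnerProductSpace ℝ (V b)] [FiberBundle F V]
    [VectorBundle ℝ F V] [IsContinuousRiemannianBundle F V] {μ : Measure B}
    (v : SqIntegrableSection F V μ) : ‖v‖ₑ ^ 2 = ∫⁻ b, ‖v.field b‖ₑ ^ 2 ∂μ := by
  have hint : Integrable (fun b ↦ ‖v.field b‖ ^ 2) μ := v.2.2
  rw [← ofReal_norm, ← ENNReal.ofReal_pow (norm_nonneg _), v.norm_eq,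
    Real.sq_sqrt (integral_nonneg fun _ ↦ by positivity),
    ofReal_integral_eq_lintegral_ofReal hint (ae_of_all _ fun _ ↦ by positivity)]
  simp only [ENNReal.ofReal_pow (norm_nonneg _), ofReal_norm]

variable {E : Type*} [NormedAddCommGroup E] [NormedSpace ℝ E]
  {E' : Type*} [NormedAddCommGroup E'] [NormedSpace ℝ E']
  {M : Type*} [MetricSpace M] [MeasurableSpace M] [ChartedSpace E M]
  [RiemannianBundle (fun x : M ↦ TangentSpace 𝓘(ℝ, E) x)]
  {N : Type*} [MetricSpace N] [ChartedSpace E' N]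
  [RiemannianBundle (fun y : N ↦ TangentSpace 𝓘(ℝ, E') y)]
  {f : M → N} {μ : Measure M}

lemma lintegral_enorm_mfderiv_apply_sq_le
    (hb : essSup (fun x ↦ ‖mfderiv 𝓘(ℝ, E) 𝓘(ℝ, E') f x‖ₑ) μ ≠ ⊤)
    (v : ∀ x : M, TangentSpace 𝓘(ℝ, E) x) :
    ∫⁻ x, ‖mfderiv 𝓘(ℝ, E) 𝓘(ℝ, E') f x (v x)‖ₑ ^ 2 ∂μ ≤
      essSup (fun x ↦ ‖mfderiv 𝓘(ℝ, E) 𝓘(ℝ, E') f x‖ₑ) μ ^ 2 * ∫⁻ x, ‖v x‖ₑ ^ 2 ∂μ := by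
  rw [← lintegral_const_mul' _ _ (ENNReal.pow_ne_top hb)]
  refine lintegral_mono_ae ?_
  filter_upwards [ENNReal.ae_le_essSup fun x ↦ ‖mfderiv 𝓘(ℝ, E) 𝓘(ℝ, E') f x‖ₑ] with x hx
  rw [← mul_pow]
  gcongr
  exact ((mfderiv 𝓘(ℝ, E) 𝓘(ℝ, E') f x).le_opENorm (v x)).trans (by gcongr)

lemma essSup_sq_mul_lintegral_enorm_sq_lt_top [FiniteDimensional ℝ E]
    [SecondCountableTopology M] [BorelSpace M] [IsManifold 𝓘(ℝ, E) ∞ M]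
    [IsContMDiffRiemannianBundle 𝓘(ℝ, E) ∞ E (fun x : M ↦ TangentSpace 𝓘(ℝ, E) x)]
    (hb : essSup (fun x ↦ ‖mfderiv 𝓘(ℝ, E) 𝓘(ℝ, E') f x‖ₑ) μ ≠ ⊤) (v : SqIntegrableField E μ) :
    essSup (fun x ↦ ‖mfderiv 𝓘(ℝ, E) 𝓘(ℝ, E') f x‖ₑ) μ ^ 2 * ∫⁻ x, ‖v.field x‖ₑ ^ 2 ∂μ < ⊤ := by
  rw [← v.enorm_sq]
  exact ENNReal.mul_lt_top (ENNReal.pow_lt_top hb.lt_top) (ENNReal.pow_lt_top enorm_lt_top)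

variable [BorelSpace M] [IsManifold 𝓘(ℝ, E) ∞ M] [FiniteDimensional ℝ E']
  [MeasurableSpace N] [IsManifold 𝓘(ℝ, E') ∞ N]
  [IsContMDiffRiemannianBundle 𝓘(ℝ, E') ∞ E' (fun y : N ↦ TangentSpace 𝓘(ℝ, E') y)]
  {κ : Kernel N M}

/-- The `L²` bound behind the continuity of the operator, obtained by integrating the fibrewise
Cauchy–Schwarz inequality over `N`. -/
lemma IsDisintegration.lintegral_enorm_fibreAverage_sq_le (h : IsDisintegration f μ κ)
    (hf : ContMDiff 𝓘(ℝ, E) 𝓘(ℝ, E') ∞ f)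
    (hb : essSup (fun x ↦ ‖mfderiv 𝓘(ℝ, E) 𝓘(ℝ, E') f x‖ₑ) μ ≠ ⊤)
    {v : ∀ x : M, TangentSpace 𝓘(ℝ, E) x} (hv : MeasurableSection E v) :
    ∫⁻ y, ‖fibreAverage E E' f κ v y‖ₑ ^ 2 ∂(μ.map f) ≤
      essSup (fun x ↦ ‖mfderiv 𝓘(ℝ, E) 𝓘(ℝ, E') f x‖ₑ) μ ^ 2 * ∫⁻ x, ‖v x‖ₑ ^ 2 ∂μ :=
  calc _ ≤ ∫⁻ y, ∫⁻ x, ‖mfderiv 𝓘(ℝ, E) 𝓘(ℝ, E') f x (v x)‖ₑ ^ 2 ∂(κ y) ∂(μ.map f) :=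
        lintegral_mono fun y ↦ h.enorm_fibreAverage_sq_le hf hv y
    _ = ∫⁻ x, ‖mfderiv 𝓘(ℝ, E) 𝓘(ℝ, E') f x (v x)‖ₑ ^ 2 ∂μ :=
        (h.lintegral_eq_lintegral ((measurable_enorm_mfderiv_apply hf hv).pow_const 2)).symm
    _ ≤ _ := lintegral_enorm_mfderiv_apply_sq_le hb v

variable [FiniteDimensional ℝ E] [SecondCountableTopology M]
  [IsContMDiffRiemannianBundle 𝓘(ℝ, E) ∞ E (fun x : M ↦ TangentSpace 𝓘(ℝ, E) x)]

/-- For almost every `y` the field is square-integrable, hence integrable, along the fibre. -/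
lemma IsDisintegration.ae_integrableOn_fibreVector (h : IsDisintegration f μ κ)
    (hf : ContMDiff 𝓘(ℝ, E) 𝓘(ℝ, E') ∞ f)
    (hb : essSup (fun x ↦ ‖mfderiv 𝓘(ℝ, E) 𝓘(ℝ, E') f x‖ₑ) μ ≠ ⊤) (v : SqIntegrableField E μ) :
    ∀ᵐ y ∂(μ.map f), IntegrableOn (fibreVector E E' f v.field y) (f ⁻¹' {y}) (κ y) := by
  have hv : MeasurableSection E v.field := v.2.1
  have hm := (measurable_enorm_mfderiv_apply hf hv).pow_const 2
  have hlt : ∫⁻ y, ∫⁻ x, ‖mfderiv 𝓘(ℝ, E) 𝓘(ℝ, E') f x (v.field x)‖ₑ ^ 2 ∂(κ y) ∂(μ.map f) ≠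
      ⊤ := by
    rw [← h.lintegral_eq_lintegral hm]
    exact ((lintegral_enorm_mfderiv_apply_sq_le hb v.field).trans_lt
      (essSup_sq_mul_lintegral_enorm_sq_lt_top hb v)).ne
  filter_upwards [ae_lt_top hm.lintegral_kernel hlt] with y hy
  have := h.isProbability y
  have hsm := aestronglyMeasurable_fibreVector hf hv y (κ y)
  have h2 : MemLp (fibreVector E E' f v.field y) 2 ((κ y).restrict (f ⁻¹' {y})) := by
    refine ⟨hsm, (eLpNorm_lt_top_iff_lintegral_rpow_enorm_lt_top two_ne_zero
      ENNReal.ofNat_ne_top).2 ?_⟩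
    simp only [ENNReal.toReal_ofNat, ENNReal.rpow_ofNat]
    refine lt_of_le_of_lt ?_ ((setLIntegral_le_lintegral (f ⁻¹' {y}) _).trans_lt hy)
    refine (setLIntegral_congr_fun (measurableSet_fiber hf.continuous y) fun x hx ↦ ?_).le
    simp only [enorm_fibreVector hx]
  exact h2.integrable one_le_two

variable [BorelSpace N] [SecondCountableTopology N]

/-- The fibre average of a square-integrable field, as a square-integrable field. -/
def IsDisintegration.averageSection (h : IsDisintegration f μ κ)
    (hf : ContMDiff 𝓘(ℝ, E) 𝓘(ℝ, E') ∞ f)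
    (hb : essSup (fun x ↦ ‖mfderiv 𝓘(ℝ, E) 𝓘(ℝ, E') f x‖ₑ) μ ≠ ⊤) (v : SqIntegrableField E μ) :
    SqIntegrableField E' (μ.map f) :=
  have := h.isMarkovKernel
  have hmeas := measurableSection_fibreAverage (κ := κ) (E' := E') hf v.2.1
  .of (fibreAverage E E' f κ v.field) hmeas <| by
    refine ⟨(hmeas.measurable_norm.pow_const 2).aestronglyMeasurable, ?_⟩
    simp only [HasFiniteIntegral, enorm_pow, enorm_norm]
    exact (h.lintegral_enorm_fibreAverage_sq_le hf hb v.2.1).trans_lt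
      (essSup_sq_mul_lintegral_enorm_sq_lt_top hb v)

lemma IsDisintegration.norm_averageSection_le (h : IsDisintegration f μ κ)
    (hf : ContMDiff 𝓘(ℝ, E) 𝓘(ℝ, E') ∞ f)
    (hb : essSup (fun x ↦ ‖mfderiv 𝓘(ℝ, E) 𝓘(ℝ, E') f x‖ₑ) μ ≠ ⊤) (v : SqIntegrableField E μ) :
    ‖h.averageSection hf hb v‖ ≤
      (essSup (fun x ↦ ‖mfderiv 𝓘(ℝ, E) 𝓘(ℝ, E') f x‖ₑ) μ).toReal * ‖v‖ := by
  have h2 : ‖h.averageSection hf hb v‖ₑ ^ 2 ≤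
      (essSup (fun x ↦ ‖mfderiv 𝓘(ℝ, E) 𝓘(ℝ, E') f x‖ₑ) μ * ‖v‖ₑ) ^ 2 := by
    rw [mul_pow, SqIntegrableSection.enorm_sq, SqIntegrableSection.enorm_sq]
    exact h.lintegral_enorm_fibreAverage_sq_le hf hb v.2.1
  have h1 := (ENNReal.pow_le_pow_left_iff two_ne_zero).1 h2
  simpa using ENNReal.toReal_mono (ENNReal.mul_ne_top hb enorm_ne_top) h1

/-- The fibre average as an operator `L²(TM, μ) → L²(TN, f_# μ)`. Additivity holds only after
passing to classes, since the fibre integrals converge only for almost every `y`. -/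
def IsDisintegration.averageCLM (h : IsDisintegration f μ κ)
    (hf : ContMDiff 𝓘(ℝ, E) 𝓘(ℝ, E') ∞ f)
    (hb : essSup (fun x ↦ ‖mfderiv 𝓘(ℝ, E) 𝓘(ℝ, E') f x‖ₑ) μ ≠ ⊤) :
    LTwoFields E μ →L[ℝ] LTwoFields E' (μ.map f) :=
  SeparationQuotient.liftCLM
    (LinearMap.mkContinuous
      { toFun := fun v ↦ LTwo.mk (h.averageSection hf hb v)
        map_add' := fun v w ↦ by
          refine (LTwo.mk_eq_mk_iff _ (_ + _)).2 ?_
          filter_upwards [h.ae_integrableOn_fibreVector hf hb v,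
            h.ae_integrableOn_fibreVector hf hb w] with y hv hw
          change ∫ x in _, fibreVector E E' f (v.field + w.field) y x ∂(κ y) = _
          rw [fibreVector_add]
          exact integral_add hv hw
        map_smul' := fun c v ↦ by
          refine (LTwo.mk_eq_mk_iff _ (_ • _)).2 (ae_of_all _ fun y ↦ ?_)
          change ∫ x in _, fibreVector E E' f (c • v.field) y x ∂(κ y) = _
          rw [fibreVector_smul]
          exact integral_smul c _ }
      (essSup (fun x ↦ ‖mfderiv 𝓘(ℝ, E) 𝓘(ℝ, E') f x‖ₑ) μ).toReal
      fun v ↦ h.norm_averageSection_le hf hb v)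
    fun _ _ hvw ↦ (hvw.map (ContinuousLinearMap.continuous _)).eq

lemma IsDisintegration.enorm_averageCLM_comp_subtypeL_le (h : IsDisintegration f μ κ)
    (hf : ContMDiff 𝓘(ℝ, E) 𝓘(ℝ, E') ∞ f)
    (hb : essSup (fun x ↦ ‖mfderiv 𝓘(ℝ, E) 𝓘(ℝ, E') f x‖ₑ) μ ≠ ⊤)
    (S : Submodule ℝ (LTwoFields E μ)) :
    ‖(h.averageCLM hf hb).comp S.subtypeL‖ₑ ≤
      essSup (fun x ↦ ‖mfderiv 𝓘(ℝ, E) 𝓘(ℝ, E') f x‖ₑ) μ := by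
  rw [← ofReal_norm]
  refine ENNReal.ofReal_le_of_le_toReal
    (ContinuousLinearMap.opNorm_le_bound _ ENNReal.toReal_nonneg fun u ↦ ?_)
  obtain ⟨⟨v⟩, _⟩ := u
  exact h.norm_averageSection_le hf hb v

/-- Two disintegrations agree for almost every `y`, so they give the same class. -/
lemma IsDisintegration.mk_averageSection_eq [StandardBorelSpace M] [Nonempty M] [IsFiniteMeasure μ]
    {κ' : Kernel N M} (h : IsDisintegration f μ κ) (h' : IsDisintegration f μ κ')
    (hf : ContMDiff 𝓘(ℝ, E) 𝓘(ℝ, E') ∞ f)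
    (hb : essSup (fun x ↦ ‖mfderiv 𝓘(ℝ, E) 𝓘(ℝ, E') f x‖ₑ) μ ≠ ⊤) (v : SqIntegrableField E μ) :
    LTwo.mk (h.averageSection hf hb v) = LTwo.mk (h'.averageSection hf hb v) := by
  rw [LTwo.mk_eq_mk_iff]
  filter_upwards [h.ae_eq hf.continuous.measurable h'] with y hy
  change ∫ x in _, _ ∂(κ y) = ∫ x in _, _ ∂(κ' y)
  rw [hy]

end Operator

end WassersteinGeometry

end

theorem mainTheorem8
    {E : Type*} [NormedAddCommGroup E] [NormedSpace ℝ E] [FiniteDimensional ℝ E]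
    {E' : Type*} [NormedAddCommGroup E'] [NormedSpace ℝ E'] [FiniteDimensional ℝ E']
    {M : Type*} [MetricSpace M] [ConnectedSpace M] [CompleteSpace M] [SecondCountableTopology M]
    [MeasurableSpace M] [BorelSpace M] [ChartedSpace E M] [IsManifold 𝓘(ℝ, E) ∞ M]
    [RiemannianBundle (fun x : M ↦ TangentSpace 𝓘(ℝ, E) x)]
    [IsContMDiffRiemannianBundle 𝓘(ℝ, E) ∞ E (fun x : M ↦ TangentSpace 𝓘(ℝ, E) x)]
    [IsRiemannianManifold 𝓘(ℝ, E) M]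
    {N : Type*} [MetricSpace N] [ConnectedSpace N] [CompleteSpace N] [SecondCountableTopology N]
    [MeasurableSpace N] [BorelSpace N] [ChartedSpace E' N] [IsManifold 𝓘(ℝ, E') ∞ N]
    [RiemannianBundle (fun y : N ↦ TangentSpace 𝓘(ℝ, E') y)]
    [IsContMDiffRiemannianBundle 𝓘(ℝ, E') ∞ E' (fun y : N ↦ TangentSpace 𝓘(ℝ, E') y)]
    [IsRiemannianManifold 𝓘(ℝ, E') N]
    (f : M → N) (hf : ContMDiff 𝓘(ℝ, E) 𝓘(ℝ, E') ∞ f) (hproper : IsProperMap f)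
    (hb : ∃ C : ℝ, ∀ x, ‖mfderiv 𝓘(ℝ, E) 𝓘(ℝ, E') f x‖ ≤ C)
    (μ : WassersteinSpace M) :
    (∃ κ : Kernel N M, IsDisintegration f μ.toMeasure κ) ∧
    ∃ dF : wassersteinTangent E μ.toMeasure →L[ℝ]
        LTwoFields E' (WassersteinSpace.map E E' f hf hb μ).toMeasure,
      (∀ κ : Kernel N M, IsDisintegration f μ.toMeasure κ →
        ∀ (v : SqIntegrableField E μ.toMeasure)
          (hv : LTwo.mk v ∈ wassersteinTangent E μ.toMeasure),
        (∀ᵐ y ∂(WassersteinSpace.map E E' f hf hb μ).toMeasure,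
          IntegrableOn (fibreVector E E' f v.field y) (f ⁻¹' {y}) (κ y)) ∧
        ∃ w : SqIntegrableField E' (WassersteinSpace.map E E' f hf hb μ).toMeasure,
          (∀ y, w.field y = fibreAverage E E' f κ v.field y) ∧ dF ⟨LTwo.mk v, hv⟩ = LTwo.mk w) ∧
      ‖dF‖ₑ ≤ essSup (fun x ↦ ‖mfderiv 𝓘(ℝ, E) 𝓘(ℝ, E') f x‖ₑ) μ.toMeasure := by
  have := μ.isProbabilityMeasure
  have hfm : Measurable f := hf.continuous.measurable
  have hκ : IsDisintegration f μ.toMeasure (condDistrib id f μ.toMeasure) :=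
    isDisintegration_condDistrib hfm
  -- The supremum of `‖df‖` is finite, hence so is the essential supremum with respect to `μ`.
  have hess : essSup (fun x ↦ ‖mfderiv 𝓘(ℝ, E) 𝓘(ℝ, E') f x‖ₑ) μ.toMeasure ≠ ⊤ := by
    obtain ⟨C, hC⟩ := hb
    refine ne_top_of_le_ne_top (ENNReal.ofReal_ne_top (r := C)) ?_
    refine essSup_le_of_ae_le _ (ae_of_all _ fun x ↦ ?_)
    beta_reduce
    rw [← ofReal_norm]
    exact ENNReal.ofReal_le_ofReal (hC x)
  refine ⟨⟨_, hκ⟩, (hκ.averageCLM hf hess).comp (wassersteinTangent E μ.toMeasure).subtypeL,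
    fun κ h v hv ↦ ⟨h.ae_integrableOn_fibreVector hf hess v,
      h.averageSection hf hess v, fun y ↦ rfl, hκ.mk_averageSection_eq h hf hess v⟩,
    hκ.enorm_averageCLM_comp_subtypeL_le hf hess _⟩
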